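/- Let $r\in\omega$. Let $Q\subseteq 3^\omega\times(2^\omega)^r$ be a $\Pi^0_1$ class (the set of infinite paths through a computable tree) that has full projection on $3^\omega$, i.e. for every $X\in 3^\omega$ there is $Y\in(2^\omega)^r$ with $(X,Y)\in Q$. Let $D\in 2^\omega$ be incomputable. Call two colorings $C_0,C_1\in k^\omega$ almost disjoint if $C_0^{-1}(j)\cap C_1^{-1}(j)$ is finite for every $j<k$. Then there exist $(X^0,Y^0),(X^1,Y^1)\in Q$, where $Y^i=(Y^i_0,\dots,Y^i_{r-1})$, such that 1. $X^0$ and $X^1$ are almost disjoint; 2. for every $s<r$, $Y^0_s$ and $Y^1_s$ are not almost disjoint; 3. $(X^0,Y^0)\oplus(X^1,Y^1)\not\geq_T D$, i.e. the join of the two members does not compute $D$. -/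

import Mathlib

/-- The length-`n` initial segment of an infinite sequence. -/
def initSeg {α : Type*} (Z : ℕ → α) (n : ℕ) : List α :=
  (List.range n).map Z

/-- A set of finite strings is a tree if it is closed under initial segments. -/
def IsStringTree {α : Type*} (T : Set (List α)) : Prop :=
  ∀ σ τ : List α, σ <+: τ → τ ∈ T → σ ∈ T

/-- The set `[T]` of infinite paths through `T`. -/
def treePaths {α : Type*} (T : Set (List α)) : Set (ℕ → α) :=
  {Z | ∀ n, initSeg Z n ∈ T}

/-- A (lightface) `Π⁰₁` class of sequences over the alphabet `α`: the set of infinite paths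
through a computable tree of finite strings over `α`. -/
def IsPi01Class {α : Type*} [Primcodable α] (P : Set (ℕ → α)) : Prop :=
  ∃ T : Set (List α), IsStringTree T ∧ ComputablePred (fun σ : List α => σ ∈ T) ∧
    P = treePaths T

/-- The product space `3^ω × (2^ω)^r`. -/
abbrev ColoringSpace (r : ℕ) : Type :=
  (ℕ → Fin 3) × (Fin r → ℕ → Fin 2)

/-- The standard identification of `3^ω × (2^ω)^r` with `(3 × 2^r)^ω`: the tuple
`(X, Y_0, …, Y_{r-1})` becomes the sequence `n ↦ (X n, (Y_0 n, …, Y_{r-1} n))`. -/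
def asSeq (r : ℕ) : ColoringSpace r ≃ (ℕ → Fin 3 × (Fin r → Fin 2)) where
  toFun p n := (p.1 n, fun s => p.2 s n)
  invFun Z := (fun n => (Z n).1, fun s n => (Z n).2 s)
  left_inv _ := rfl
  right_inv _ := rfl

/-- `Q ⊆ 3^ω × (2^ω)^r` is a `Π⁰₁` class. -/
def IsPi01 {r : ℕ} (Q : Set (ColoringSpace r)) : Prop :=
  IsPi01Class (asSeq r '' Q)

/-- Every `X ∈ 3^ω` is the first component of a member of `Q`. -/
def HasFullProjection {r : ℕ} (Q : Set (ColoringSpace r)) : Prop :=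
  ∀ X : ℕ → Fin 3, ∃ Y : Fin r → ℕ → Fin 2, (X, Y) ∈ Q

/-- Two `k`-colorings of `ω` are almost disjoint if, for each color, only finitely many numbers
receive that color from both of them. -/
def AlmostDisjoint {k : ℕ} (X₀ X₁ : ℕ → Fin k) : Prop :=
  ∀ j : Fin k, (X₀ ⁻¹' {j} ∩ X₁ ⁻¹' {j}).Finite

/-- A sequence over a coded alphabet, as a function `ℕ → ℕ`. For `α = Fin k` the code of a letter
is its numerical value. -/
def seqOracle {α : Type*} [Primcodable α] (Z : ℕ → α) : ℕ → ℕ :=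
  fun n => Encodable.encode (Z n)

/-- The join `f ⊕ g`: it has value `f n` at `2 * n` and `g n` at `2 * n + 1`. -/
def oracleJoin (f g : ℕ → ℕ) : ℕ → ℕ :=
  fun n => if n % 2 = 0 then f (n / 2) else g (n / 2)

/-- The join `(X⁰, Y⁰) ⊕ (X¹, Y¹)` of two points of `3^ω × (2^ω)^r`, as an oracle. -/
def pointJoin {r : ℕ} (p₀ p₁ : ColoringSpace r) : ℕ → ℕ :=
  oracleJoin (seqOracle (asSeq r p₀)) (seqOracle (asSeq r p₁))

/-! ### Compactness over a finite alphabet -/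

section InitialSegments

variable {α : Type*}

/-! Take a set `S` of coordinates, maximal such that above some string `ρ` every `X` has a solution
whose `S`-coordinates follow one fixed sequence `V`. By maximality and compactness
(`exists_escapeBound`), for any further coordinate `s` and any values prescribed on `S` and `s`,
every string of length `m` has an extension of some length `l` over which no solution follows those
values on `[m, l)`; `l` depends on `m` alone and is found computably. A solution that follows `V` on
`S` is thereby forced to deviate in `s`.

This yields solutions, called leaves, that follow `V` on `S` and such that any two differ infinitely
often in each coordinate outside `S` (`exists_separated_paths`). On each interval between levels at
most one of them is active and the others have color 0, so at most two colors occur at each place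
and a third is left for a further solution, the center, which also follows `V` on `S`.

Such a star of `r + 1` leaves and a center is a path through a computable tree: `V` need not be
computable, but the tree only asks leaves and center to agree on `S`. The cone avoidance theorem for
`Π⁰₁` classes then gives a star that does not compute `D`.

Some leaf agrees infinitely often with the center in every coordinate. Otherwise each leaf
eventually opposes the center in some coordinate, necessarily outside `S`; two of the `r + 1` leaves
share this coordinate, hence eventually agree in it, against their separation. That leaf and the
center are the required pair. -/

@[simp]
theorem length_initSeg (Z : ℕ → α) (n : ℕ) : (initSeg Z n).length = n := by
  simp [initSeg]

theorem getElem?_initSeg {Z : ℕ → α} {n i : ℕ} (h : i < n) : (initSeg Z n)[i]? = some (Z i) := by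
  simp [initSeg, h]

theorem take_initSeg (Z : ℕ → α) {m n : ℕ} (h : m ≤ n) :
    (initSeg Z n).take m = initSeg Z m := by
  simp [initSeg, ← List.map_take, List.take_range, h]

theorem initSeg_prefix (Z : ℕ → α) {m n : ℕ} (h : m ≤ n) : initSeg Z m <+: initSeg Z n := by
  rw [← take_initSeg Z h]
  exact List.take_prefix _ _

theorem map_initSeg {β : Type*} (f : α → β) (Z : ℕ → α) (n : ℕ) :
    (initSeg Z n).map f = initSeg (f ∘ Z) n := by
  simp [initSeg]

theorem initSeg_inj {Z W : ℕ → α} {n : ℕ} : initSeg Z n = initSeg W n ↔ ∀ i < n, Z i = W i := by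
  simp [initSeg, List.map_inj_left]

theorem initSeg_eq_iff {Z : ℕ → α} {σ : List α} :
    initSeg Z σ.length = σ ↔ ∀ i (h : i < σ.length), Z i = σ[i] := by
  constructor
  · intro h i hi
    have := getElem?_initSeg (Z := Z) hi
    rw [h, List.getElem?_eq_getElem hi] at this
    exact (Option.some.inj this).symm
  · intro h
    apply List.ext_getElem (by simp)
    intro i h1 h2
    simp [initSeg, h i h2]

theorem exists_initSeg_eq [Inhabited α] (σ : List α) : ∃ Z, initSeg Z σ.length = σ := by
  refine ⟨fun i => σ[i]?.getD default, initSeg_eq_iff.2 fun i hi => ?_⟩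
  simp [hi]

/-- The set of sequences all of whose initial segments satisfy `A`. -/
def pathsOf (A : List α → Prop) : Set (ℕ → α) :=
  {Z | ∀ n, A (initSeg Z n)}

theorem isClosed_pathsOf [TopologicalSpace α] [DiscreteTopology α] (A : List α → Prop) :
    IsClosed (pathsOf A) := by
  have : pathsOf A = ⋂ n, {Z | A (initSeg Z n)} := by
    ext Z
    simp [pathsOf]
  rw [this]
  refine isClosed_iInter fun n => ?_
  have h : {Z : ℕ → α | A (initSeg Z n)} =
      (fun Z (i : Fin n) => Z i) ⁻¹' {v | A (List.ofFn v)} := by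
    ext Z
    simp only [Set.mem_ofPred_eq, Set.mem_preimage]
    rw [show List.ofFn (fun i : Fin n => Z i) = initSeg Z n from ?_]
    apply List.ext_getElem <;> simp [initSeg]
  rw [h]
  exact IsClosed.preimage (by fun_prop) (isClosed_discrete _)

/-- A decreasing sequence of nonempty closed sets over a finite alphabet has a common member. -/
theorem exists_mem_iInter_pathsOf [Finite α] (A : ℕ → List α → Prop)
    (hanti : ∀ k, pathsOf (A (k + 1)) ⊆ pathsOf (A k)) (hne : ∀ k, (pathsOf (A k)).Nonempty) :
    ∃ Z, ∀ k, Z ∈ pathsOf (A k) := by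
  let _ : TopologicalSpace α := ⊥
  have : DiscreteTopology α := ⟨rfl⟩
  obtain ⟨Z, hZ⟩ := IsCompact.nonempty_iInter_of_sequence_nonempty_isCompact_isClosed
    (fun k => pathsOf (A k)) hanti hne (isClosed_pathsOf _).isCompact
    (fun k => isClosed_pathsOf _)
  exact ⟨Z, Set.mem_iInter.1 hZ⟩

/-- König's lemma for trees over a finite alphabet. -/
theorem exists_path_of_forall_length [Finite α] {A : List α → Prop}
    (hA : ∀ σ τ, σ <+: τ → A τ → A σ) (h : ∀ n, ∃ σ, σ.length = n ∧ A σ) :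
    (pathsOf A).Nonempty := by
  rcases isEmpty_or_nonempty α with hα | hα
  · obtain ⟨σ, hσ, -⟩ := h 1
    obtain ⟨a, -⟩ := List.exists_mem_of_length_pos (l := σ) (by omega)
    exact hα.elim a
  have : Inhabited α := Classical.inhabited_of_nonempty hα
  -- The `k`-th closed set imposes `A` only up to length `k`, so one string of length `k` makes it
  -- nonempty.
  obtain ⟨Z, hZ⟩ := exists_mem_iInter_pathsOf (fun k σ => σ.length ≤ k → A σ)
    (fun k Z hZ n hn => hZ n (by omega)) (fun k => by
      obtain ⟨σ, rfl, hσ⟩ := h k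
      obtain ⟨Z, hZ⟩ := exists_initSeg_eq σ
      refine ⟨Z, fun n hn => hA _ σ ?_ hσ⟩
      rw [← hZ]
      exact initSeg_prefix Z (by simpa using hn))
  exact ⟨Z, fun n => hZ n n (by simp)⟩

/-- The list of all strings of length `n` over a finite alphabet. -/
noncomputable def allStrings (α : Type*) [Fintype α] : ℕ → List (List α)
  | 0 => [[]]
  | n + 1 => (allStrings α n).flatMap fun σ => Finset.univ.toList.map fun a => a :: σ

theorem mem_allStrings [Fintype α] {n : ℕ} {σ : List α} :
    σ ∈ allStrings α n ↔ σ.length = n := by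
  induction n generalizing σ with
  | zero => simp [allStrings]
  | succ n ih =>
    cases σ with
    | nil => simp [allStrings]
    | cons a σ => simp [allStrings, ih]

theorem primrec_allStrings [Fintype α] [Primcodable α] : Primrec (allStrings α) := by
  refine (Primrec.nat_rec₁ (f := fun _ L => L.flatMap fun σ =>
    (Finset.univ.toList : List α).map fun a => a :: σ) [[]] ?_).of_eq fun n => ?_
  · refine Primrec.list_flatMap Primrec.snd ?_
    refine Primrec.list_map (Primrec.const _) ?_
    exact Primrec.list_cons.comp Primrec.snd (Primrec.snd.comp Primrec.fst)
  · induction n with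
    | zero => rfl
    | succ n ih => simp only [allStrings, ← ih]

end InitialSegments

/-! ### Closure properties of computable and r.e. predicates -/

section ComputablePredicates

variable {α β γ : Type*} [Primcodable α] [Primcodable β] [Primcodable γ]

theorem ComputablePred.comp {p : β → Prop} (hp : ComputablePred p) {f : α → β}
    (hf : Computable f) : ComputablePred fun a => p (f a) := by
  classical
  exact Computable.computablePred (hp.decide.comp hf)

theorem ComputablePred.and {p q : α → Prop} (hp : ComputablePred p) (hq : ComputablePred q) :
    ComputablePred fun a => p a ∧ q a := by
  classical
  exact Computable.computablePred
    ((Primrec.and.to_comp.comp hp.decide hq.decide).of_eq fun a => by simp)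

theorem ComputablePred.or {p q : α → Prop} (hp : ComputablePred p) (hq : ComputablePred q) :
    ComputablePred fun a => p a ∨ q a :=
  (hp.not.and hq.not).not.of_eq fun a => by tauto

theorem ComputablePred.imp {p q : α → Prop} (hp : ComputablePred p) (hq : ComputablePred q) :
    ComputablePred fun a => p a → q a :=
  (hp.not.or hq).of_eq fun a => by tauto

/-- Recursion on the index accumulates the conjunction; an index out of range counts as `true`, the
neutral value. -/
theorem ComputablePred.forall_mem_list {p : α → β → Prop}
    (hp : ComputablePred fun x : α × β => p x.1 x.2) {f : α → List β} (hf : Computable f) :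
    ComputablePred fun a => ∀ b ∈ f a, p a b := by
  classical
  obtain ⟨g, hg, hpg⟩ := ComputablePred.computable_iff.1 hp
  have hgp : ∀ a b, p a b ↔ g (a, b) = true := fun a b => by
    have := congrFun hpg (a, b)
    simpa using this
  have hget : Computable fun x : α × ℕ × Bool => (f x.1)[x.2.1]? :=
    Computable.list_getElem?.comp (hf.comp Computable.fst) (Computable.fst.comp Computable.snd)
  have hdec : Computable₂ fun (x : α × ℕ × Bool) (b : β) => g (x.1, b) :=
    hg.comp ((Computable.fst.comp Computable.fst).pair Computable.snd)
  have hb : Computable₂ fun (a : α) (y : ℕ × Bool) =>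
      (y.2 && (((f a)[y.1]?).map fun b => g (a, b)).getD true) :=
    Primrec.and.to_comp.comp (Computable.snd.comp Computable.snd)
      (Computable.option_getD (Computable.option_map hget hdec) (Computable.const true))
  have := Computable.nat_rec (Computable.list_length.comp hf) (Computable.const true) hb
  refine Computable.computablePred (this.of_eq fun a => ?_)
  rw [Bool.eq_iff_iff, decide_eq_true_iff]
  have key : ∀ n, (Nat.rec (motive := fun _ => Bool) true (fun i ih =>
      (ih && (((f a)[i]?).map fun b => g (a, b)).getD true)) n = true) ↔
      ∀ i < n, ∀ b, (f a)[i]? = some b → p a b := by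
    intro n
    induction n with
    | zero => simp
    | succ n ih =>
      simp only [Bool.and_eq_true, ih, Nat.forall_lt_succ_right]
      refine and_congr_right fun _ => ?_
      cases (f a)[n]? <;> simp [hgp]
  refine (key _).trans ?_
  constructor
  · intro h b hb
    obtain ⟨i, hi, rfl⟩ := List.getElem_of_mem hb
    exact h i hi _ (List.getElem?_eq_getElem hi)
  · intro h i _ b hb
    exact h b (List.mem_of_getElem? hb)

theorem ComputablePred.exists_mem_list {p : α → β → Prop}
    (hp : ComputablePred fun x : α × β => p x.1 x.2) {f : α → List β} (hf : Computable f) :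
    ComputablePred fun a => ∃ b ∈ f a, p a b :=
  (ComputablePred.forall_mem_list (p := fun a b => ¬ p a b) hp.not hf).not.of_eq
    fun a => by push Not; rfl

theorem ComputablePred.forall_lt {p : α → ℕ → Prop}
    (hp : ComputablePred fun x : α × ℕ => p x.1 x.2) {f : α → ℕ} (hf : Computable f) :
    ComputablePred fun a => ∀ n < f a, p a n :=
  (ComputablePred.forall_mem_list hp (Primrec.list_range.to_comp.comp hf)).of_eq
    fun a => by simp

theorem ComputablePred.exists_lt {p : α → ℕ → Prop}
    (hp : ComputablePred fun x : α × ℕ => p x.1 x.2) {f : α → ℕ} (hf : Computable f) :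
    ComputablePred fun a => ∃ n < f a, p a n :=
  (ComputablePred.exists_mem_list hp (Primrec.list_range.to_comp.comp hf)).of_eq
    fun a => by simp

theorem ComputablePred.forall_fintype [Fintype β] {p : α → β → Prop}
    (hp : ComputablePred fun x : α × β => p x.1 x.2) : ComputablePred fun a => ∀ b, p a b :=
  (ComputablePred.forall_mem_list hp (Computable.const (Finset.univ : Finset β).toList)).of_eq
    fun a => by simp

theorem ComputablePred.forall_length_eq [Fintype β] {p : α → List β → Prop}
    (hp : ComputablePred fun x : α × List β => p x.1 x.2) {f : α → ℕ} (hf : Computable f) :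
    ComputablePred fun a => ∀ σ : List β, σ.length = f a → p a σ :=
  (ComputablePred.forall_mem_list hp (primrec_allStrings.to_comp.comp hf)).of_eq
    fun a => by simp [mem_allStrings]

theorem ComputablePred.exists_length_eq [Fintype β] {p : α → List β → Prop}
    (hp : ComputablePred fun x : α × List β => p x.1 x.2) {f : α → ℕ} (hf : Computable f) :
    ComputablePred fun a => ∃ σ : List β, σ.length = f a ∧ p a σ :=
  (ComputablePred.exists_mem_list hp (primrec_allStrings.to_comp.comp hf)).of_eq
    fun a => by simp [mem_allStrings]

theorem Computable.eqPred {f g : α → β} (hf : Computable f) (hg : Computable g) :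
    ComputablePred fun a => f a = g a := by
  classical
  exact (Primrec.eq (α := β)).computablePred.comp (hf.pair hg)

theorem Computable.lePred {f g : α → ℕ} (hf : Computable f) (hg : Computable g) :
    ComputablePred fun a => f a ≤ g a :=
  Primrec.nat_le.computablePred.comp (hf.pair hg)

theorem REPred.comp {p : β → Prop} (hp : REPred p) {f : α → β} (hf : Computable f) :
    REPred fun a => p (f a) :=
  Partrec.comp hp hf

/-- A recursively enumerable predicate is approximated by computable stages. -/
theorem REPred.exists_stage {p : α → Prop} (hp : REPred p) :
    ∃ q : α → ℕ → Prop, ComputablePred (fun x : α × ℕ => q x.1 x.2) ∧ ∀ a, p a ↔ ∃ t, q a t := by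
  obtain ⟨c, hc⟩ := Nat.Partrec.Code.exists_code.1 hp
  refine ⟨fun a t => (c.evaln t (Encodable.encode a)).isSome, ?_, fun a => ?_⟩
  · refine Computable.computablePred (p := fun x : α × ℕ =>
      ((c.evaln x.2 (Encodable.encode x.1)).isSome = true)) ?_
    refine (Primrec.to_comp (?_ : Primrec fun x : α × ℕ =>
      (c.evaln x.2 (Encodable.encode x.1)).isSome)).of_eq fun x => by simp
    exact Primrec.option_isSome.comp (Nat.Partrec.Code.primrec_evaln.comp
      ((Primrec.snd.pair (Primrec.const c)).pair (Primrec.encode.comp Primrec.fst)))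
  · have h1 : p a ↔ (c.eval (Encodable.encode a)).Dom := by
      rw [hc]
      simp only [Encodable.encodek, Part.coe_some, Part.bind_some, Part.map_Dom, Part.assert]
      exact ⟨fun h => ⟨h, trivial⟩, fun h => h.1⟩
    rw [h1, Part.dom_iff_mem]
    simp only [Nat.Partrec.Code.evaln_complete, Option.isSome_iff_exists]
    exact exists_comm

theorem ComputablePred.exists_nat {q : α → ℕ → Prop}
    (hq : ComputablePred fun x : α × ℕ => q x.1 x.2) : REPred fun a => ∃ t, q a t := by
  classical
  have h : Partrec fun a => Nat.rfind fun n => Part.some (decide (q a n)) :=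
    Partrec.rfind hq.decide.partrec
  refine h.dom_re.of_eq fun a => ?_
  refine Nat.rfind_dom.trans ?_
  constructor
  · rintro ⟨n, hn, -⟩
    exact ⟨n, by simpa using hn⟩
  · rintro ⟨n, hn⟩
    exact ⟨n, by simpa using hn, fun _ => trivial⟩

theorem REPred.or {p q : α → Prop} (hp : REPred p) (hq : REPred q) :
    REPred fun a => p a ∨ q a := by
  obtain ⟨s, hs, hps⟩ := hp.exists_stage
  obtain ⟨t, ht, hqt⟩ := hq.exists_stage
  refine (ComputablePred.exists_nat (q := fun a n => s a n ∨ t a n) (hs.or ht)).of_eq fun a => ?_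
  rw [hps, hqt, exists_or]

/-- Emptiness of a `Π⁰₁` class over a finite alphabet is recursively enumerable, uniformly in a
parameter. -/
theorem REPred.forall_path [Fintype β] {R : α → List β → Prop}
    (hR : REPred fun x : α × List β => R x.1 x.2) :
    REPred fun a => ∀ Z : ℕ → β, ∃ n, R a (initSeg Z n) := by
  obtain ⟨q, hq, hRq⟩ := hR.exists_stage
  -- By König's lemma emptiness shows at a single level `l`: every string of length `l` has a prefix
  -- enumerated into `R` at a stage `t ≤ l`. Using the length as the bound on stages makes the
  -- surviving strings a tree.
  have hc : ComputablePred fun x : α × ℕ => ∀ σ : List β, σ.length = x.2 →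
      ∃ n < x.2 + 1, ∃ t < x.2 + 1, q (x.1, σ.take n) t := by
    refine ComputablePred.forall_length_eq (p := fun (x : α × ℕ) σ =>
      ∃ n < x.2 + 1, ∃ t < x.2 + 1, q (x.1, σ.take n) t) ?_ Computable.snd
    have hs : Computable fun x : (α × ℕ) × List β => x.1.2 + 1 :=
      Computable.succ.comp (Computable.snd.comp Computable.fst)
    refine ComputablePred.exists_lt (p := fun (x : (α × ℕ) × List β) n =>
      ∃ t < x.1.2 + 1, q (x.1.1, x.2.take n) t) ?_ hs
    refine ComputablePred.exists_lt (p := fun (x : ((α × ℕ) × List β) × ℕ) t =>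
      q (x.1.1.1, x.1.2.take x.2) t) ?_ (hs.comp Computable.fst)
    refine hq.comp (Computable.pair (Computable.pair ?_ ?_) Computable.snd)
    · exact Computable.fst.comp (Computable.fst.comp (Computable.fst.comp Computable.fst))
    · exact Primrec.list_take.to_comp.comp (Computable.snd.comp Computable.fst)
        (Computable.snd.comp (Computable.fst.comp Computable.fst))
  refine (ComputablePred.exists_nat (q := fun a l => ∀ σ : List β, σ.length = l →
      ∃ n < l + 1, ∃ t < l + 1, q (a, σ.take n) t) hc).of_eq fun a => ?_
  constructor
  · rintro ⟨l, hl⟩ Z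
    obtain ⟨n, hn, t, -, h⟩ := hl (initSeg Z l) (by simp)
    rw [take_initSeg Z (by omega)] at h
    exact ⟨n, (hRq (a, _)).2 ⟨t, h⟩⟩
  · intro h
    by_contra! hcon
    obtain ⟨Z, hZ⟩ := exists_path_of_forall_length
      (A := fun σ : List β => ∀ n < σ.length + 1, ∀ t < σ.length + 1, ¬ q (a, σ.take n) t)
      (fun σ τ hστ hτ n hn t ht => by
        have hl := hστ.length_le
        have := hτ n (by omega) t (by omega)
        rwa [List.prefix_iff_eq_take.1 hστ, List.take_take, min_eq_left (by omega)])
      (fun l => by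
        obtain ⟨σ, hσ, h⟩ := hcon l
        exact ⟨σ, hσ, by rw [hσ]; exact h⟩)
    obtain ⟨n, hn⟩ := h Z
    obtain ⟨t, ht⟩ := (hRq (a, _)).1 hn
    refine hZ (max n t) n (by simp) t (by simp) ?_
    rwa [take_initSeg Z (le_max_left _ _)]

end ComputablePredicates

/-! ### Oracle computations and the use principle -/

section FiniteUse

/-- A partial functional on oracles, given by its computations from finite parts of the oracle. -/
structure IsUseFunctional (F : List ℕ → ℕ → Part ℕ) : Prop where
  partrec : Partrec fun x : List ℕ × ℕ => F x.1 x.2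
  mono : ∀ {σ τ : List ℕ}, σ <+: τ → ∀ {n m : ℕ}, m ∈ F σ n → m ∈ F τ n

theorem IsUseFunctional.mono_initSeg {F : List ℕ → ℕ → Part ℕ} (hF : IsUseFunctional F) (g : ℕ → ℕ)
    {k l n m : ℕ} (hkl : k ≤ l) (h : m ∈ F (initSeg g k) n) : m ∈ F (initSeg g l) n :=
  hF.mono (initSeg_prefix g hkl) h

theorem IsUseFunctional.of_partrec {f : ℕ → Part ℕ} (hf : Partrec f) : IsUseFunctional fun _ => f :=
  ⟨hf.comp Computable.snd, fun _ _ _ h => h⟩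

theorem IsUseFunctional.oracle : IsUseFunctional fun σ n => (σ[n]? : Part ℕ) where
  partrec := Computable.ofOption Computable.list_getElem?
  mono h n m hm := by
    simp only [Part.mem_coe, Option.mem_def] at hm ⊢
    obtain ⟨ρ, rfl⟩ := h
    rw [List.getElem?_append_left]
    · exact hm
    · exact (List.getElem?_eq_some_iff.1 hm).1

theorem IsUseFunctional.pair {F H : List ℕ → ℕ → Part ℕ} (hF : IsUseFunctional F)
    (hH : IsUseFunctional H) :
    IsUseFunctional fun σ n => (F σ n).bind fun a => (H σ n).map (Nat.pair a) where
  partrec := by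
    refine Partrec.bind hF.partrec (Partrec.map (hH.partrec.comp
      ((Computable.fst.comp Computable.fst).pair (Computable.snd.comp Computable.fst))) ?_)
    exact Primrec₂.natPair.to_comp.comp (Computable.snd.comp Computable.fst) Computable.snd
  mono h n m hm := by
    simp only [Part.mem_bind_iff, Part.mem_map_iff] at hm ⊢
    obtain ⟨a, ha, b, hb, rfl⟩ := hm
    exact ⟨a, hF.mono h ha, b, hH.mono h hb, rfl⟩

theorem IsUseFunctional.comp {F H : List ℕ → ℕ → Part ℕ} (hF : IsUseFunctional F)
    (hH : IsUseFunctional H) : IsUseFunctional fun σ n => (H σ n).bind fun a => F σ a where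
  partrec := Partrec.bind hH.partrec
    (hF.partrec.comp ((Computable.fst.comp Computable.fst).pair Computable.snd))
  mono h n m hm := by
    simp only [Part.mem_bind_iff] at hm ⊢
    obtain ⟨a, ha, hm⟩ := hm
    exact ⟨a, hH.mono h ha, hF.mono h hm⟩

/-- Primitive recursion on partial functionals. -/
def precFunctional (F H : List ℕ → ℕ → Part ℕ) (σ : List ℕ) (p : ℕ) : Part ℕ :=
  p.unpair.2.rec (F σ p.unpair.1) fun y IH =>
    IH.bind fun i => H σ (Nat.pair p.unpair.1 (Nat.pair y i))

/-- Two different pairs are allowed because this serves both to lengthen a finite oracle and to pass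
from a finite oracle to the full computation. -/
theorem mem_prec_mono {F F' H H' : ℕ → Part ℕ} (hF : ∀ n m, m ∈ F n → m ∈ F' n)
    (hH : ∀ n m, m ∈ H n → m ∈ H' n) {a n m : ℕ}
    (h : m ∈ (Nat.rec (motive := fun _ => Part ℕ) (F a)
      (fun y IH => IH.bind fun i => H (Nat.pair a (Nat.pair y i))) n)) :
    m ∈ (Nat.rec (motive := fun _ => Part ℕ) (F' a)
      (fun y IH => IH.bind fun i => H' (Nat.pair a (Nat.pair y i))) n) := by
  induction n generalizing m with
  | zero => exact hF _ _ h
  | succ n ih =>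
    simp only [Part.mem_bind_iff] at h ⊢
    obtain ⟨i, hi, h⟩ := h
    exact ⟨i, ih hi, hH _ _ h⟩

theorem IsUseFunctional.prec {F H : List ℕ → ℕ → Part ℕ} (hF : IsUseFunctional F)
    (hH : IsUseFunctional H) : IsUseFunctional (precFunctional F H) where
  partrec := by
    have hu : Computable fun x : List ℕ × ℕ => x.2.unpair :=
      Computable.unpair.comp Computable.snd
    refine Partrec.nat_rec (f := fun x : List ℕ × ℕ => x.2.unpair.2)
      (g := fun x => F x.1 x.2.unpair.1)
      (h := fun x y => H x.1 (Nat.pair x.2.unpair.1 (Nat.pair y.1 y.2)))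
      (Computable.snd.comp hu)
      (hF.partrec.comp (Computable.fst.pair (Computable.fst.comp hu))) ?_
    have hp : Computable fun x : (List ℕ × ℕ) × (ℕ × ℕ) =>
        Nat.pair x.1.2.unpair.1 (Nat.pair x.2.1 x.2.2) :=
      Primrec₂.natPair.to_comp.comp (Computable.fst.comp (hu.comp Computable.fst))
        (Primrec₂.natPair.to_comp.comp (Computable.fst.comp Computable.snd)
          (Computable.snd.comp Computable.snd))
    exact hH.partrec.comp ((Computable.fst.comp Computable.fst).pair hp)
  mono {σ τ} h n m hm := mem_prec_mono (F := F σ) (F' := F τ) (H := H σ) (H' := H τ)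
    (fun _ _ h' => hF.mono h h') (fun _ _ h' => hH.mono h h') hm

theorem IsUseFunctional.rfind {F : List ℕ → ℕ → Part ℕ} (hF : IsUseFunctional F) :
    IsUseFunctional fun σ a =>
      Nat.rfind fun n => (F σ (Nat.pair a n)).map fun m => decide (m = 0) where
  partrec := by
    refine Partrec.rfind (p := fun (x : List ℕ × ℕ) n =>
      (F x.1 (Nat.pair x.2 n)).map fun m => decide (m = 0)) (Partrec.map (hF.partrec.comp
        ((Computable.fst.comp Computable.fst).pair (Primrec₂.natPair.to_comp.comp
          (Computable.snd.comp Computable.fst) Computable.snd))) ?_)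
    exact (Primrec.eq (α := ℕ)).decide.to_comp.comp Computable.snd (Computable.const 0)
  mono {σ τ} h n m hm := by
    have hm := Nat.mem_rfind.1 hm
    have key : ∀ {a : ℕ} {b : Bool}, b ∈ (F σ a).map (fun m => decide (m = 0)) →
        b ∈ (F τ a).map (fun m => decide (m = 0)) := by
      intro a b hb
      obtain ⟨c, hc, rfl⟩ := (Part.mem_map_iff _).1 hb
      exact (Part.mem_map_iff _).2 ⟨c, hF.mono h hc, rfl⟩
    exact Nat.mem_rfind.2 ⟨key hm.1, fun hlt => key (hm.2 hlt)⟩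

/-- `F` computes `f` from the oracle `g`. -/
def UseComputes (F : List ℕ → ℕ → Part ℕ) (g : ℕ → ℕ) (f : ℕ →. ℕ) : Prop :=
  ∀ n m, m ∈ f n ↔ ∃ k, m ∈ F (initSeg g k) n

/-- The use principle: a computation from an oracle uses only a finite part of it. -/
theorem exists_useFunctional {g : ℕ → ℕ} {f : ℕ →. ℕ} (hf : Nat.RecursiveIn {(g : ℕ →. ℕ)} f) :
    ∃ F, IsUseFunctional F ∧ UseComputes F g f := by
  have base : ∀ f : ℕ →. ℕ, Partrec f → ∃ F, IsUseFunctional F ∧ UseComputes F g f :=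
    fun f hf => ⟨_, IsUseFunctional.of_partrec hf, fun n m => by simp⟩
  induction hf with
  | zero => exact base _ (Partrec.nat_iff.2 .zero)
  | succ => exact base _ (Partrec.nat_iff.2 .succ)
  | left => exact base _ (Partrec.nat_iff.2 .left)
  | right => exact base _ (Partrec.nat_iff.2 .right)
  | oracle f hfg =>
    obtain rfl := Set.mem_singleton_iff.1 hfg
    refine ⟨_, IsUseFunctional.oracle, fun n m => ?_⟩
    simp only [Part.mem_coe, Option.mem_def, PFun.coe_val, Part.mem_some_iff]
    constructor
    · rintro rfl
      exact ⟨n + 1, getElem?_initSeg (Nat.lt_succ_self n)⟩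
    · rintro ⟨k, hk⟩
      have hn : n < k := by simpa using (List.getElem?_eq_some_iff.1 hk).1
      rw [getElem?_initSeg hn] at hk
      exact (Option.some.inj hk).symm
  | pair _ _ ih₁ ih₂ =>
    obtain ⟨F, hF, hFf⟩ := ih₁
    obtain ⟨H, hH, hHh⟩ := ih₂
    refine ⟨_, hF.pair hH, fun n m => ?_⟩
    simp only [Part.map_eq_map, Seq.seq, Part.mem_bind_iff, Part.mem_map_iff]
    constructor
    · rintro ⟨_, ⟨a, ha, rfl⟩, b, hb, rfl⟩
      obtain ⟨k, hk⟩ := (hFf _ _).1 ha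
      obtain ⟨l, hl⟩ := (hHh _ _).1 hb
      exact ⟨max k l, a, hF.mono_initSeg g (le_max_left _ _) hk, b,
        hH.mono_initSeg g (le_max_right _ _) hl, rfl⟩
    · rintro ⟨k, a, ha, b, hb, rfl⟩
      exact ⟨_, ⟨a, (hFf _ _).2 ⟨k, ha⟩, rfl⟩, b, (hHh _ _).2 ⟨k, hb⟩, rfl⟩
  | comp _ _ ih₁ ih₂ =>
    obtain ⟨F, hF, hFf⟩ := ih₁
    obtain ⟨H, hH, hHh⟩ := ih₂
    refine ⟨_, hF.comp hH, fun n m => ⟨fun h => ?_, ?_⟩⟩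
    · obtain ⟨a, ha, hm⟩ := Part.mem_bind_iff.1 h
      obtain ⟨k, hk⟩ := (hHh _ _).1 ha
      obtain ⟨l, hl⟩ := (hFf _ _).1 hm
      exact ⟨max k l, Part.mem_bind_iff.2 ⟨a, hH.mono_initSeg g (le_max_left _ _) hk,
        hF.mono_initSeg g (le_max_right _ _) hl⟩⟩
    · rintro ⟨k, h⟩
      obtain ⟨a, ha, hm⟩ := Part.mem_bind_iff.1 h
      exact Part.mem_bind_iff.2 ⟨a, (hHh _ _).2 ⟨k, ha⟩, (hFf _ _).2 ⟨k, hm⟩⟩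
  | @prec f h _ _ ih₁ ih₂ =>
    obtain ⟨F, hF, hFf⟩ := ih₁
    obtain ⟨H, hH, hHh⟩ := ih₂
    refine ⟨_, hF.prec hH, fun p m => ?_⟩
    constructor
    · intro hm
      change m ∈ (Nat.rec (motive := fun _ => Part ℕ) (f p.unpair.1)
        (fun y IH => IH.bind fun i => h (Nat.pair p.unpair.1 (Nat.pair y i))) p.unpair.2) at hm
      change ∃ k, m ∈ (Nat.rec (motive := fun _ => Part ℕ) (F (initSeg g k) p.unpair.1)
        (fun y IH => IH.bind fun i =>
          H (initSeg g k) (Nat.pair p.unpair.1 (Nat.pair y i))) p.unpair.2)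
      generalize p.unpair.2 = n at hm ⊢
      induction n generalizing m with
      | zero => exact (hFf _ _).1 hm
      | succ n ih =>
        simp only [Part.mem_bind_iff] at hm ⊢
        obtain ⟨i, hi, hm⟩ := hm
        obtain ⟨k, hk⟩ := ih i hi
        obtain ⟨l, hl⟩ := (hHh _ _).1 hm
        exact ⟨max k l, i, mem_prec_mono (F := F (initSeg g k)) (H := H (initSeg g k))
          (F' := F (initSeg g (max k l))) (H' := H (initSeg g (max k l)))
          (fun _ _ h' => hF.mono_initSeg g (le_max_left k l) h')
          (fun _ _ h' => hH.mono_initSeg g (le_max_left k l) h') hk,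
          hH.mono_initSeg g (le_max_right _ _) hl⟩
    · rintro ⟨k, hk⟩
      exact mem_prec_mono (fun n m h => (hFf n m).2 ⟨k, h⟩) (fun n m h => (hHh n m).2 ⟨k, h⟩) hk
  | @rfind f _ ih =>
    obtain ⟨F, hF, hFf⟩ := ih
    refine ⟨_, hF.rfind, fun a m => ⟨fun h => ?_, ?_⟩⟩
    · obtain ⟨hz, hlt⟩ := Nat.mem_rfind.1 h
      obtain ⟨z, hz, hz0⟩ := (Part.mem_map_iff _).1 hz
      obtain ⟨k, hk⟩ := (hFf _ _).1 hz
      have : ∀ i, ∃ l, i < m → ∃ b ∈ F (initSeg g l) (Nat.pair a i), decide (b = 0) = false := by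
        intro i
        by_cases hi : i < m
        · obtain ⟨b, hb, hb0⟩ := (Part.mem_map_iff _).1 (hlt hi)
          obtain ⟨l, hl⟩ := (hFf _ _).1 hb
          exact ⟨l, fun _ => ⟨b, hl, hb0⟩⟩
        · exact ⟨0, fun h => absurd h hi⟩
      choose l hl using this
      -- The search inspects only the arguments up to `m`, so the maximum of finitely many uses
      -- suffices.
      refine ⟨max k ((Finset.range m).sup l), Nat.mem_rfind.2 ⟨(Part.mem_map_iff _).2
        ⟨z, hF.mono_initSeg g (le_max_left _ _) hk, hz0⟩, fun {i} hi => ?_⟩⟩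
      obtain ⟨b, hb, hb0⟩ := hl i hi
      exact (Part.mem_map_iff _).2 ⟨b, hF.mono_initSeg g
        ((Finset.le_sup (Finset.mem_range.2 hi)).trans (le_max_right _ _)) hb, hb0⟩
    · rintro ⟨k, h⟩
      obtain ⟨hz, hlt⟩ := Nat.mem_rfind.1 h
      have key : ∀ {i : ℕ} {b : Bool},
          b ∈ (F (initSeg g k) (Nat.pair a i)).map (fun m => decide (m = 0)) →
          b ∈ (f (Nat.pair a i)).map (fun m => decide (m = 0)) := by
        intro i b hb
        obtain ⟨c, hc, rfl⟩ := (Part.mem_map_iff _).1 hb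
        exact (Part.mem_map_iff _).2 ⟨c, (hFf _ _).2 ⟨k, hc⟩, rfl⟩
      exact Nat.mem_rfind.2 ⟨key hz, fun hi => key (hlt hi)⟩

/-- There are only countably many partial recursive functionals. -/
theorem exists_seq_useFunctional :
    ∃ F : ℕ → List ℕ → ℕ → Part ℕ, (∀ e, IsUseFunctional (F e)) ∧
      ∀ H, IsUseFunctional H → ∃ e, F e = H := by
  classical
  let ev : Nat.Partrec.Code → List ℕ → ℕ → Part ℕ := fun c σ n =>
    c.eval (Encodable.encode (σ, n))
  have hne : IsUseFunctional fun _ n => Part.some n := IsUseFunctional.of_partrec Partrec.some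
  -- Codes that do not give a monotone functional are replaced by a dummy. The list need not be
  -- effective: only its individual members must be partial recursive.
  refine ⟨fun e => if IsUseFunctional (ev (Denumerable.ofNat Nat.Partrec.Code e))
    then ev (Denumerable.ofNat Nat.Partrec.Code e) else fun _ n => Part.some n, fun e => ?_,
    fun H hH => ?_⟩
  · by_cases h : IsUseFunctional (ev (Denumerable.ofNat Nat.Partrec.Code e))
    · simpa only [if_pos h] using h
    · simpa only [if_neg h] using hne
  · obtain ⟨c, hc⟩ := Nat.Partrec.Code.exists_code.1 hH.partrec
    have hcH : ev c = H := by
      funext σ n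
      have := congrFun hc (Encodable.encode (σ, n))
      simp only [Encodable.encodek, Part.coe_some, Part.bind_some] at this
      exact this.trans (Part.map_id' (fun _ => rfl) _)
    refine ⟨Encodable.encode c, ?_⟩
    simp only [Denumerable.ofNat_encode, hcH, if_pos hH]

end FiniteUse

/-! ### Cone avoidance for `Π⁰₁` classes -/

section ConeAvoidance

variable {α : Type*} [Fintype α] [Primcodable α]

/-- Both `D n = 1` and its negation `D n = 0` are r.e., so Post's theorem applies. -/
theorem computable_of_rePred_eq {D : ℕ → Fin 2} (hD : REPred fun x : ℕ × Fin 2 => D x.1 = x.2) :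
    Computable D := by
  classical
  have h : ComputablePred fun n => D n = 1 := by
    refine ComputablePred.computable_iff_re_compl_re.2
      ⟨hD.comp (Computable.id.pair (Computable.const 1)), ?_⟩
    refine (hD.comp (Computable.id.pair (Computable.const 0))).of_eq fun n => ?_
    have : ∀ d : Fin 2, d = 0 ↔ ¬ d = 1 := by decide
    exact this _
  refine (Computable.cond h.decide (Computable.const 1) (Computable.const 0)).of_eq fun n => ?_
  have : ∀ d : Fin 2, (bif decide (d = 1) then (1 : Fin 2) else 0) = d := by decide
  exact this _

/-- A nonempty class with recursively enumerable set of forbidden strings can be refined to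
one whose members do not compute `D` by a given functional. -/
theorem exists_refinement_not_useComputes {R : List α → Prop} (hR : REPred R)
    (hne : (pathsOf fun σ => ¬ R σ).Nonempty) {D : ℕ → Fin 2} (hD : ¬ Computable D)
    {F : List ℕ → ℕ → Part ℕ} (hF : IsUseFunctional F) :
    ∃ R' : List α → Prop, REPred R' ∧ (pathsOf fun σ => ¬ R' σ).Nonempty ∧
      (∀ σ, R σ → R' σ) ∧
      ∀ Z ∈ pathsOf fun σ => ¬ R' σ, ¬ UseComputes F (seqOracle Z) (seqOracle D) := by
  classical
  -- Avoiding `B (n, d)` means staying in the given class while `F` never outputs `d` at `n`.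
  let B : ℕ × Fin 2 → List α → Prop := fun x σ =>
    R σ ∨ (x.2 : ℕ) ∈ F (σ.map Encodable.encode) x.1
  have hB : REPred fun x : (ℕ × Fin 2) × List α => B x.1 x.2 := by
    refine (hR.comp Computable.snd).or ?_
    have hF' : Partrec fun x : (ℕ × Fin 2) × List α =>
        (F (x.2.map Encodable.encode) x.1.1).bind fun m =>
          Part.assert ((x.1.2 : ℕ) = m) fun _ => Part.some () := by
      have hmap : Primrec fun σ : List α => σ.map Encodable.encode :=
        Primrec.list_map Primrec.id (Primrec.encode.comp Primrec.snd).to₂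
      refine Partrec.bind (hF.partrec.comp
        ((hmap.to_comp.comp Computable.snd).pair (Computable.fst.comp Computable.fst))) ?_
      have : ComputablePred fun y : ((ℕ × Fin 2) × List α) × ℕ => (y.1.1.2 : ℕ) = y.2 :=
        Computable.eqPred (Primrec.fin_val.to_comp.comp
          (Computable.snd.comp (Computable.fst.comp Computable.fst))) Computable.snd
      exact this.to_re
    refine hF'.dom_re.of_eq fun x => ?_
    simp only [Part.dom_iff_mem, Part.mem_bind_iff, Part.mem_assert_iff, Part.mem_some_iff]
    constructor
    · rintro ⟨_, m, hm, rfl, -⟩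
      exact hm
    · intro h
      exact ⟨(), _, h, rfl, trivial⟩
  by_cases hex : ∃ n, (pathsOf fun σ => ¬ B (n, D n) σ).Nonempty
  · obtain ⟨n, hn⟩ := hex
    refine ⟨B (n, D n), hB.comp ((Computable.const _).pair Computable.id), hn,
      fun σ h => Or.inl h, fun Z hZ hcomp => ?_⟩
    obtain ⟨k, hk⟩ := (hcomp n (D n : ℕ)).1 (by
      simp only [seqOracle, PFun.coe_val, Part.mem_some_iff]
      rfl)
    refine hZ k (Or.inr ?_)
    rwa [map_initSeg]
  · exfalso
    push Not at hex
    -- Now every member of the class computes `D` through `F`. Hence `d = D n` exactly when the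
    -- class avoiding `B (n, d)` is empty, an r.e. condition; nonemptiness of the original class
    -- rules out other `d`.
    refine hD (computable_of_rePred_eq ((REPred.forall_path hB).of_eq ?_))
    have hempty : ∀ n, ∀ Z : ℕ → α, ∃ k, B (n, D n) (initSeg Z k) := by
      intro n Z
      by_contra! hcon
      exact Set.notMem_empty Z (hex n ▸ hcon)
    rintro ⟨n, d⟩
    constructor
    · intro h
      obtain ⟨Z, hZ⟩ := hne
      obtain ⟨k, hk⟩ := h Z
      obtain ⟨l, hl⟩ := hempty n Z
      have hk := hk.resolve_left (hZ k)
      have hl := hl.resolve_left (hZ l)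
      rw [map_initSeg] at hk hl
      have := Part.mem_unique (hF.mono_initSeg _ (le_max_left k l) hk)
        (hF.mono_initSeg _ (le_max_right k l) hl)
      exact (Fin.ext this).symm
    · intro h
      rw [← show D n = d from h]
      exact hempty n

/-- The cone avoidance theorem for nonempty `Π⁰₁` classes over a finite alphabet. -/
theorem exists_mem_pathsOf_not_turingReducible {A : List α → Prop} (hA : ComputablePred A)
    (hne : (pathsOf A).Nonempty) {D : ℕ → Fin 2} (hD : ¬ Computable D) :
    ∃ Z ∈ pathsOf A, ¬ TuringReducible (seqOracle D : ℕ →. ℕ) (seqOracle Z : ℕ →. ℕ) := by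
  obtain ⟨F, hF, hFsurj⟩ := exists_seq_useFunctional
  let C := {R : List α → Prop // REPred R ∧ (pathsOf fun σ => ¬ R σ).Nonempty}
  have step : ∀ (R : C) (e : ℕ), ∃ R' : C, (∀ σ, R.1 σ → R'.1 σ) ∧
      ∀ Z ∈ pathsOf fun σ => ¬ R'.1 σ, ¬ UseComputes (F e) (seqOracle Z) (seqOracle D) := by
    intro R e
    obtain ⟨R', h1, h2, h3, h4⟩ := exists_refinement_not_useComputes R.2.1 R.2.2 hD (hF e)
    exact ⟨⟨R', h1, h2⟩, h3, h4⟩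
  choose next hnext hnext' using step
  let R₀ : C := ⟨fun σ => ¬ A σ, hA.not.to_re, by simpa using hne⟩
  let R : ℕ → C := fun n => Nat.rec R₀ (fun e R => next R e) n
  obtain ⟨Z, hZ⟩ := exists_mem_iInter_pathsOf (fun k σ => ¬ (R k).1 σ)
    (fun k Z hZ n h => hZ n (hnext (R k) k _ h)) (fun k => (R k).2.2)
  refine ⟨Z, fun n => not_not.1 (hZ 0 n), fun hred => ?_⟩
  obtain ⟨H, hH, hcomp⟩ := exists_useFunctional (RecursiveIn.iff_nat.1 hred)
  obtain ⟨e, rfl⟩ := hFsurj H hH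
  exact hnext' (R e) e Z (hZ (e + 1)) hcomp

end ConeAvoidance

/-! ### Maximal constant coordinates and escape from prescribed values -/

section Escape

/-- The letters of the alphabet `3 × 2^r`. -/
abbrev Letter (r : ℕ) : Type := Fin 3 × (Fin r → Fin 2)

variable {r : ℕ}

/-- Every extension of `ρ` is the first component of a path of `T` whose coordinates in `S` are,
from `ρ.length` on, given by a fixed sequence `V`. -/
def IsConstantAbove (T : Set (List (Letter r))) (S : Finset (Fin r)) (ρ : List (Fin 3))
    (V : ℕ → Fin r → Fin 2) : Prop :=
  ∀ X : ℕ → Fin 3, initSeg X ρ.length = ρ → ∃ Z ∈ treePaths T, (∀ n, (Z n).1 = X n) ∧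
    ∀ n, ρ.length ≤ n → ∀ t ∈ S, (Z n).2 t = V n t

/-- The coordinates in `S` of the string `π` are given by `v` from position `m` on. -/
def MatchesFrom (S : Finset (Fin r)) (m : ℕ) (π : List (Letter r)) (v : List (Fin r → Fin 2)) :
    Prop :=
  ∀ n < π.length, m ≤ n → ∀ t, t ∈ S → (π[n]?.map fun a => a.2 t) = (v[n]?.map fun w => w t)

theorem MatchesFrom.take {S : Finset (Fin r)} {m : ℕ} {π : List (Letter r)}
    {v : List (Fin r → Fin 2)} (h : MatchesFrom S m π v) (k : ℕ) :
    MatchesFrom S m (π.take k) (v.take k) := by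
  intro n hn hm t ht
  rw [List.length_take] at hn
  have := h n (by omega) hm t ht
  rwa [List.getElem?_take_of_lt (by omega), List.getElem?_take_of_lt (by omega)]

theorem matchesFrom_initSeg {S : Finset (Fin r)} {m k : ℕ} {Z : ℕ → Letter r}
    {V : ℕ → Fin r → Fin 2} :
    MatchesFrom S m (initSeg Z k) (initSeg V k) ↔
      ∀ n < k, m ≤ n → ∀ t ∈ S, (Z n).2 t = V n t := by
  simp only [MatchesFrom, length_initSeg]
  refine forall_congr' fun n => forall_congr' fun hn => ?_
  simp [getElem?_initSeg hn]

/-- `v` guides the coordinates in `S` of strings of `T` above each extension of `ρ` of the same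
length as `v`. -/
def Guides (T : Set (List (Letter r))) (S : Finset (Fin r)) (ρ : List (Fin 3))
    (v : List (Fin r → Fin 2)) : Prop :=
  ∀ τ : List (Fin 3), τ.length = v.length → τ.take ρ.length = ρ →
    ∃ π ∈ T, π.map Prod.fst = τ ∧ MatchesFrom S ρ.length π v

theorem Guides.of_prefix {T : Set (List (Letter r))} (hT : IsStringTree T) {S : Finset (Fin r)}
    {ρ : List (Fin 3)} {v w : List (Fin r → Fin 2)} (hvw : v <+: w) (hw : Guides T S ρ w) :
    Guides T S ρ v := by
  intro τ hτ hρ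
  have hl := hvw.length_le
  have hρl : ρ.length ≤ τ.length := by
    rw [← hρ, List.length_take]
    exact min_le_right _ _
  -- The padding by 0 is arbitrary: any extension of `τ` to the length of `w` would do.
  obtain ⟨π, hπ, hπτ, hm⟩ := hw (τ ++ List.replicate (w.length - v.length) 0)
    (by simp; omega) (by rw [List.take_append_of_le_length hρl, hρ])
  refine ⟨π.take v.length, hT _ _ (List.take_prefix _ _) hπ, ?_, ?_⟩
  · rw [List.map_take, hπτ, List.take_append_of_le_length hτ.ge, ← hτ, List.take_length]
  · rw [List.prefix_iff_eq_take.1 hvw]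
    simpa [hl] using hm.take v.length

/-- For a fixed `X` above `ρ`, the strings of `T` over `X` that match `V` form a finitely branching
tree, to which König's lemma applies. -/
theorem isConstantAbove_of_guides {T : Set (List (Letter r))} (hT : IsStringTree T)
    {S : Finset (Fin r)} {ρ : List (Fin 3)} {V : ℕ → Fin r → Fin 2}
    (hV : ∀ n, Guides T S ρ (initSeg V n)) : IsConstantAbove T S ρ V := by
  intro X hX
  obtain ⟨Z, hZ⟩ := exists_path_of_forall_length
    (A := fun π : List (Letter r) => π ∈ T ∧ π.map Prod.fst = initSeg X π.length ∧
      MatchesFrom S ρ.length π (initSeg V π.length))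
    (fun σ τ hστ ⟨h1, h2, h3⟩ => by
      have hl := hστ.length_le
      refine ⟨hT _ _ hστ h1, ?_, ?_⟩
      · conv_lhs => rw [List.prefix_iff_eq_take.1 hστ]
        rw [List.map_take, h2, take_initSeg X hl]
      · have := h3.take σ.length
        rwa [← List.prefix_iff_eq_take.1 hστ, take_initSeg V hl] at this)
    (fun n => by
      -- Below the length of `ρ` guiding is vacuous, so the string is taken at a longer level and
      -- cut back.
      obtain ⟨π, h1, h2, h3⟩ := hV (max n ρ.length) (initSeg X (max n ρ.length)) (by simp)
        (by rw [take_initSeg X (le_max_right _ _), hX])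
      have hlen : π.length = max n ρ.length := by simpa using congrArg List.length h2
      have hn : (π.take n).length = n := by simp [hlen]
      refine ⟨π.take n, hn, hT _ _ (List.take_prefix _ _) h1, ?_, ?_⟩
      · rw [hn, List.map_take, h2, take_initSeg X (le_max_left _ _)]
      · have := h3.take n
        rw [take_initSeg V (le_max_left _ _)] at this
        rwa [hn])
  refine ⟨Z, fun n => (hZ n).1, fun n => ?_, fun n hn t ht => ?_⟩
  · have := (hZ (n + 1)).2.1
    rw [map_initSeg, length_initSeg, initSeg_inj] at this
    exact this n (Nat.lt_succ_self n)
  · have := (hZ (n + 1)).2.2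
    rw [length_initSeg, matchesFrom_initSeg] at this
    exact this n (Nat.lt_succ_self n) hn t ht

/-- Between levels `m` and `l`, every string can be extended so as to escape any prescribed values
of the coordinates in `S` together with one further coordinate. -/
def EscapeBound (T : Set (List (Letter r))) (S : Finset (Fin r)) (m l : ℕ) : Prop :=
  m < l ∧ ∀ ρ : List (Fin 3), ρ.length = m → ∀ s, s ∉ S → ∀ v : List (Fin r → Fin 2),
    v.length = l → ∃ τ : List (Fin 3), τ.length = l ∧ (τ.take m = ρ ∧
      ∀ π : List (Letter r), π.length = l → (π ∈ T ∧ π.map Prod.fst = τ) →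
        ¬ MatchesFrom (insert s S) m π v)

/-- For fixed `ρ` and `s` the guides form a tree; guides of every length would give a limit `V`
contradicting the maximality of `S`. Failure persists at larger lengths, so one `l` serves the
finitely many `ρ` and `s`. -/
theorem exists_escapeBound {T : Set (List (Letter r))} (hT : IsStringTree T)
    {S : Finset (Fin r)} (hS : ∀ s, s ∉ S → ∀ ρ V, ¬ IsConstantAbove T (insert s S) ρ V) (m : ℕ) :
    ∃ l, EscapeBound T S m l := by
  have key : ∀ᶠ l in Filter.atTop, ∀ ρ ∈ {ρ : List (Fin 3) | ρ.length = m}, ∀ s, s ∉ S →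
      ∀ v : List (Fin r → Fin 2), v.length = l → ¬ Guides T (insert s S) ρ v := by
    rw [Filter.eventually_all_finite (List.finite_length_eq _ _)]
    intro ρ _
    rw [Filter.eventually_all]
    intro s
    by_cases hs : s ∈ S
    · simp [hs]
    have : ∃ l, ∀ v : List (Fin r → Fin 2), v.length = l → ¬ Guides T (insert s S) ρ v := by
      by_contra! hcon
      obtain ⟨V, hV⟩ := exists_path_of_forall_length
        (fun _ _ h => Guides.of_prefix hT h) hcon
      exact hS s hs ρ V (isConstantAbove_of_guides hT hV)
    obtain ⟨l, hl⟩ := this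
    filter_upwards [Filter.eventually_ge_atTop l] with k hk _ v hv hg
    exact hl (v.take l) (by simp; omega) (hg.of_prefix hT (List.take_prefix _ _))
  obtain ⟨l, hl, hml⟩ := (key.and (Filter.eventually_gt_atTop m)).exists
  refine ⟨l, hml, fun ρ hρ s hs v hv => ?_⟩
  have := hl ρ hρ s hs v hv
  simp only [Guides] at this
  push Not at this
  obtain ⟨τ, h1, h2, h3⟩ := this
  exact ⟨τ, h1.trans hv, hρ ▸ h2, fun π _ h => hρ ▸ h3 π h.1 h.2⟩

theorem primrecPred_of_finite {α : Type*} [Primcodable α] [Finite α] (p : α → Prop) :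
    PrimrecPred p := by
  classical
  exact ⟨inferInstance, Primrec.dom_finite _⟩

theorem computablePred_matchesFrom (S : Finset (Fin r)) :
    ComputablePred fun x : ((Fin r × ℕ) × List (Letter r)) × List (Fin r → Fin 2) =>
      MatchesFrom (insert x.1.1.1 S) x.1.1.2 x.1.2 x.2 := by
  refine ComputablePred.forall_lt
    (p := fun (x : ((Fin r × ℕ) × List (Letter r)) × List (Fin r → Fin 2)) n => x.1.1.2 ≤ n →
      ∀ t, t ∈ insert x.1.1.1 S → (x.1.2[n]?.map fun a => a.2 t) = (x.2[n]?.map fun w => w t))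
    ?_ (Computable.list_length.comp (Computable.snd.comp Computable.fst))
  refine ComputablePred.imp (Computable.lePred (Computable.snd.comp (Computable.fst.comp
    (Computable.fst.comp Computable.fst))) Computable.snd) ?_
  refine ComputablePred.forall_fintype
    (p := fun (x : (((Fin r × ℕ) × List (Letter r)) × List (Fin r → Fin 2)) × ℕ) t =>
      t ∈ insert x.1.1.1.1 S →
        (x.1.1.2[x.2]?.map fun a => a.2 t) = (x.1.2[x.2]?.map fun w => w t)) ?_
  have hget₁ : Primrec fun y : ((((Fin r × ℕ) × List (Letter r)) × List (Fin r → Fin 2)) × ℕ) ×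
      Fin r => y.1.1.1.2[y.1.2]? :=
    Primrec.list_getElem?.comp
      (Primrec.snd.comp (Primrec.fst.comp (Primrec.fst.comp Primrec.fst)))
      (Primrec.snd.comp Primrec.fst)
  have hget₂ : Primrec fun y : ((((Fin r × ℕ) × List (Letter r)) × List (Fin r → Fin 2)) × ℕ) ×
      Fin r => y.1.1.2[y.1.2]? :=
    Primrec.list_getElem?.comp (Primrec.snd.comp (Primrec.fst.comp Primrec.fst))
      (Primrec.snd.comp Primrec.fst)
  refine ComputablePred.imp ?_ ?_
  · have := (primrecPred_of_finite fun y : Fin r × Fin r => y.2 ∈ insert y.1 S).computablePred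
    exact this.comp ((Computable.fst.comp (Computable.fst.comp (Computable.fst.comp
      (Computable.fst.comp Computable.fst)))).pair Computable.snd)
  · refine Computable.eqPred (Primrec.to_comp ?_) (Primrec.to_comp ?_)
    · exact Primrec.option_map hget₁
        (Primrec.fin_app.comp (Primrec.snd.comp Primrec.snd) (Primrec.snd.comp Primrec.fst))
    · exact Primrec.option_map hget₂
        (Primrec.fin_app.comp Primrec.snd (Primrec.snd.comp Primrec.fst))

/-- Every quantifier ranges over a finite set: strings of a given length, coordinates, or places
below a bound. -/
theorem computablePred_escapeBound {T : Set (List (Letter r))}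
    (hT : ComputablePred fun σ => σ ∈ T) (S : Finset (Fin r)) :
    ComputablePred fun x : ℕ × ℕ => EscapeBound T S x.1 x.2 := by
  refine ComputablePred.and
    ((Computable.lePred (Computable.succ.comp Computable.fst) Computable.snd).of_eq
      fun x => Nat.succ_le_iff) ?_
  refine ComputablePred.forall_length_eq (p := fun (x : ℕ × ℕ) ρ => ∀ s, s ∉ S →
    ∀ v : List (Fin r → Fin 2), v.length = x.2 → ∃ τ : List (Fin 3), τ.length = x.2 ∧
    (τ.take x.1 = ρ ∧ ∀ π : List (Letter r), π.length = x.2 → (π ∈ T ∧ π.map Prod.fst = τ) →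
      ¬ MatchesFrom (insert s S) x.1 π v)) ?_ Computable.fst
  refine ComputablePred.forall_fintype (p := fun (x : (ℕ × ℕ) × List (Fin 3)) s => s ∉ S →
    ∀ v : List (Fin r → Fin 2), v.length = x.1.2 → ∃ τ : List (Fin 3), τ.length = x.1.2 ∧
    (τ.take x.1.1 = x.2 ∧ ∀ π : List (Letter r), π.length = x.1.2 →
      (π ∈ T ∧ π.map Prod.fst = τ) → ¬ MatchesFrom (insert s S) x.1.1 π v)) ?_
  refine ComputablePred.imp
    ((primrecPred_of_finite fun s : Fin r => s ∉ S).computablePred.comp Computable.snd) ?_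
  have h2 : Computable fun x : ((ℕ × ℕ) × List (Fin 3)) × Fin r => x.1.1.2 :=
    Computable.snd.comp (Computable.fst.comp Computable.fst)
  refine ComputablePred.forall_length_eq (p := fun (x : ((ℕ × ℕ) × List (Fin 3)) × Fin r) v =>
    ∃ τ : List (Fin 3), τ.length = x.1.1.2 ∧
    (τ.take x.1.1.1 = x.1.2 ∧ ∀ π : List (Letter r), π.length = x.1.1.2 →
      (π ∈ T ∧ π.map Prod.fst = τ) → ¬ MatchesFrom (insert x.2 S) x.1.1.1 π v)) ?_ h2
  refine ComputablePred.exists_length_eq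
    (p := fun (x : (((ℕ × ℕ) × List (Fin 3)) × Fin r) × List (Fin r → Fin 2)) τ =>
    (τ.take x.1.1.1.1 = x.1.1.2 ∧ ∀ π : List (Letter r), π.length = x.1.1.1.2 →
      (π ∈ T ∧ π.map Prod.fst = τ) → ¬ MatchesFrom (insert x.1.2 S) x.1.1.1.1 π x.2)) ?_
    (h2.comp Computable.fst)
  refine ComputablePred.and (Computable.eqPred
    (Primrec.list_take.to_comp.comp ?_ Computable.snd) ?_) ?_
  · exact Computable.fst.comp (Computable.fst.comp (Computable.fst.comp (Computable.fst.comp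
      Computable.fst)))
  · exact Computable.snd.comp (Computable.fst.comp (Computable.fst.comp Computable.fst))
  refine ComputablePred.forall_length_eq
    (p := fun (x : ((((ℕ × ℕ) × List (Fin 3)) × Fin r) × List (Fin r → Fin 2)) ×
      List (Fin 3)) π => (π ∈ T ∧ π.map Prod.fst = x.2) →
        ¬ MatchesFrom (insert x.1.1.2 S) x.1.1.1.1.1 π x.1.2) ?_
    (h2.comp (Computable.fst.comp Computable.fst))
  refine ComputablePred.imp (ComputablePred.and (hT.comp Computable.snd)
    (Computable.eqPred ?_ (Computable.snd.comp Computable.fst))) ?_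
  · have : Primrec fun π : List (Letter r) => π.map Prod.fst :=
      Primrec.list_map Primrec.id (Primrec.fst.comp Primrec.snd).to₂
    exact this.to_comp.comp Computable.snd
  · refine ComputablePred.not ((computablePred_matchesFrom S).comp
      (Computable.pair (Computable.pair (Computable.pair ?_ ?_) Computable.snd) ?_))
    · exact Computable.snd.comp (Computable.fst.comp (Computable.fst.comp Computable.fst))
    · exact Computable.fst.comp (Computable.fst.comp (Computable.fst.comp (Computable.fst.comp
        (Computable.fst.comp Computable.fst))))
    · exact Computable.snd.comp (Computable.fst.comp Computable.fst)

/-- Each level is found from the previous one by unbounded search. Computability of `h` is what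
later makes the tree of stars computable. -/
theorem exists_escapeBound_seq {T : Set (List (Letter r))} (hT : IsStringTree T)
    (hTc : ComputablePred fun σ => σ ∈ T) {S : Finset (Fin r)}
    (hS : ∀ s, s ∉ S → ∀ ρ V, ¬ IsConstantAbove T (insert s S) ρ V) (m : ℕ) :
    ∃ h : ℕ → ℕ, Computable h ∧ h 0 = m ∧ ∀ i, EscapeBound T S (h i) (h (i + 1)) := by
  classical
  have hex := exists_escapeBound hT hS
  have hc : Computable fun m => Nat.find (hex m) :=
    Computable.find (computablePred_escapeBound hTc S) hex
  refine ⟨fun n => Nat.rec m (fun _ x => Nat.find (hex x)) n, ?_, rfl, fun i => ?_⟩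
  · exact Computable.nat_rec Computable.id (Computable.const m)
      (hc.comp (Computable.snd.comp Computable.snd)).to₂
  · exact Nat.find_spec (hex _)

/-- Successive extensions of strings along a strictly increasing sequence of levels have a
limit. -/
theorem exists_limit_of_extensions {α : Type*} [Inhabited α] {h : ℕ → ℕ} (hh : StrictMono h)
    {R : ℕ → List α → Prop} {ρ : List α} (hρ : ρ.length = h 0)
    (step : ∀ i (σ : List α), σ.length = h i →
      ∃ τ : List α, τ.length = h (i + 1) ∧ τ.take (h i) = σ ∧ R i τ) :
    ∃ X : ℕ → α, initSeg X (h 0) = ρ ∧ ∀ i, R i (initSeg X (h (i + 1))) := by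
  choose! next h1 h2 h3 using step
  let τ : ℕ → List α := fun n => Nat.rec ρ (fun i σ => next i σ) n
  have hl : ∀ i, (τ i).length = h i := fun i => by
    induction i with
    | zero => exact hρ
    | succ i ih => exact h1 i _ ih
  have hpre : ∀ i k, i ≤ k → τ i <+: τ k := fun i k hik => by
    induction k, hik using Nat.le_induction with
    | base => exact List.prefix_rfl
    | succ k _ ih =>
      refine ih.trans ?_
      have := h2 k _ (hl k)
      rw [← this]
      exact List.take_prefix _ _
  -- Place `j` is read off `τ (j + 1)`, whose length `h (j + 1) ≥ j + 1` exceeds `j`; the default is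
  -- never used.
  have hX : ∀ i, initSeg (fun j => (τ (j + 1))[j]?.getD default) (h i) = τ i := fun i => by
    rw [← hl i, initSeg_eq_iff]
    intro j hj
    have hj' : j < (τ (j + 1)).length :=
      (lt_of_lt_of_le (Nat.lt_succ_self j) hh.le_apply).trans_eq (hl (j + 1)).symm
    rw [List.getElem?_eq_getElem hj', Option.getD_some]
    rcases le_total i (j + 1) with hij | hij
    · exact ((hpre _ _ hij).getElem hj).symm
    · exact (hpre _ _ hij).getElem hj'
  refine ⟨_, hX 0, fun i => ?_⟩
  rw [hX (i + 1)]
  exact h3 i _ (hl i)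

/-- A first component which escapes, on each interval `[h i, h (i + 1))` with a target, the target
sequence in the target coordinate, and vanishes on the other intervals. -/
theorem exists_escaping {T : Set (List (Letter r))} {S : Finset (Fin r)} {h : ℕ → ℕ}
    (hesc : ∀ i, EscapeBound T S (h i) (h (i + 1))) {ρ : List (Fin 3)} (hρ : ρ.length = h 0)
    (V : ℕ → Fin r → Fin 2) (tgt : ℕ → Option (Fin r × (ℕ → Fin 2)))
    (htgt : ∀ i p, tgt i = some p → p.1 ∉ S) :
    ∃ X : ℕ → Fin 3, initSeg X (h 0) = ρ ∧
      (∀ i, tgt i = none → ∀ j, h i ≤ j → j < h (i + 1) → X j = 0) ∧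
      ∀ i p, tgt i = some p → ∀ Z ∈ treePaths T, (∀ n, (Z n).1 = X n) →
        (∀ n, h 0 ≤ n → ∀ t ∈ S, (Z n).2 t = V n t) →
        ∃ j, h i ≤ j ∧ j < h (i + 1) ∧ (Z j).2 p.1 ≠ p.2 j := by
  have hh : StrictMono h := strictMono_nat_of_lt_succ fun i => (hesc i).1
  -- The values to escape are `V` with the target put in coordinate `p.1`. A path following `V` on
  -- `S` can then deviate only in `p.1`.
  let v : ℕ → Fin r × (ℕ → Fin 2) → List (Fin r → Fin 2) := fun i p =>
    initSeg (fun n => Function.update (V n) p.1 (p.2 n)) (h (i + 1))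
  obtain ⟨X, hX, hR⟩ := exists_limit_of_extensions hh (ρ := ρ)
    (R := fun i τ => (tgt i = none → ∀ j, h i ≤ j → j < h (i + 1) → τ[j]? = some 0) ∧
      (∀ p, tgt i = some p → ∀ π : List (Letter r), π.length = h (i + 1) →
        (π ∈ T ∧ π.map Prod.fst = τ) → ¬ MatchesFrom (insert p.1 S) (h i) π (v i p))) hρ (by
    intro i σ hσ
    cases ht : tgt i with
    | some p =>
      obtain ⟨τ, h1, h2, h3⟩ := (hesc i).2 σ hσ p.1 (htgt i p ht) (v i p) (by simp [v])
      refine ⟨τ, h1, h2, fun h => by simp at h, fun q hq => ?_⟩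
      obtain rfl := Option.some.inj hq
      exact h3
    | none =>
      have hlt := (hesc i).1
      refine ⟨σ ++ List.replicate (h (i + 1) - h i) 0, by simp; omega, ?_, ?_,
        fun p hp => by simp at hp⟩
      · rw [← hσ, List.take_left]
      · intro _ j hj hj'
        rw [List.getElem?_append_right (by omega), List.getElem?_replicate, if_pos (by omega)])
  refine ⟨X, hX, fun i ha j hj hj' => ?_, fun i p hp Z hZ hZX hZV => ?_⟩
  · have := (hR i).1 ha j hj hj'
    rw [getElem?_initSeg hj'] at this
    exact Option.some.inj this
  · by_contra! hcon
    refine (hR i).2 p hp (initSeg Z (h (i + 1))) (by simp) ⟨hZ _, ?_⟩ ?_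
    · rw [map_initSeg, initSeg_inj]
      exact fun n _ => hZX n
    · refine matchesFrom_initSeg.2 fun n hn hn' t ht => ?_
      by_cases hts : t = p.1
      · subst hts
        rw [Function.update_self, hcon n hn' hn]
      · rw [Function.update_of_ne hts]
        exact hZV n ((hh.monotone (Nat.zero_le i)).trans hn') t
          (Finset.mem_of_mem_insert_of_ne ht hts)

end Escape

/-! ### Separated leaves, the free color, and the tree of stars -/

section Stars

variable {r : ℕ}

theorem exists_strongRec {δ : Type*} (f : (b : ℕ) → ((a : ℕ) → a < b → δ) → δ) :
    ∃ Z : ℕ → δ, ∀ b, Z b = f b fun a _ => Z a :=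
  ⟨WellFounded.fix Nat.lt_wfRel.wf f, fun _ => WellFounded.fix_eq _ _ _⟩

/-- The `i`-th interval is reserved for separating the sequences `a` and `b` in coordinate `s`,
where `x = (a, b, s)`; every triple owns infinitely many intervals. -/
def Reserved (i : ℕ) (x : ℕ × ℕ × Fin r) : Prop :=
  Encodable.encode x = i.unpair.1

theorem Reserved.unique {i : ℕ} {x y : ℕ × ℕ × Fin r} (hx : Reserved i x) (hy : Reserved i y) :
    x = y :=
  Encodable.encode_injective (hx.trans hy.symm)

theorem exists_reserved_ge (x : ℕ × ℕ × Fin r) (m : ℕ) : ∃ i, m ≤ i ∧ Reserved i x :=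
  ⟨Nat.pair (Encodable.encode x) m, Nat.right_le_pair _ _, by simp [Reserved]⟩

theorem exists_interval {h : ℕ → ℕ} (hh : StrictMono h) {j : ℕ} (hj : h 0 ≤ j) :
    ∃ i, h i ≤ j ∧ j < h (i + 1) := by
  have hex : ∃ n, j < h n := ⟨j + 1, lt_of_lt_of_le (Nat.lt_succ_self j) hh.le_apply⟩
  classical
  have hpos : Nat.find hex ≠ 0 := fun h0 => by
    have := Nat.find_spec hex
    rw [h0] at this
    omega
  obtain ⟨i, hi⟩ := Nat.exists_eq_succ_of_ne_zero hpos
  refine ⟨i, not_lt.1 (Nat.find_min hex (by omega)), ?_⟩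
  have := Nat.find_spec hex
  rwa [hi] at this

/-- Infinitely many paths of `T` which agree in the coordinates in `S` from `h 0` on, are separated
in all other coordinates, and leave one of the three colors free at every place from `h 0` on. -/
theorem exists_separated_paths {T : Set (List (Letter r))} {S : Finset (Fin r)} {h : ℕ → ℕ}
    (hesc : ∀ i, EscapeBound T S (h i) (h (i + 1))) {ρ : List (Fin 3)} (hρ : ρ.length = h 0)
    {V : ℕ → Fin r → Fin 2} (hV : IsConstantAbove T S ρ V) :
    ∃ Z : ℕ → ℕ → Letter r, (∀ b, Z b ∈ treePaths T) ∧
      (∀ b n, h 0 ≤ n → ∀ t ∈ S, (Z b n).2 t = V n t) ∧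
      (∀ a b s i, a < b → s ∉ S → Reserved i (a, b, s) →
        ∃ j, h i ≤ j ∧ j < h (i + 1) ∧ (Z b j).2 s ≠ (Z a j).2 s) ∧
      ∀ j, h 0 ≤ j → ∃ c, ∀ b, (Z b j).1 ≠ c := by
  classical
  have step : ∀ (b : ℕ) (prev : (a : ℕ) → a < b → ℕ → Letter r), ∃ z : ℕ → Letter r,
      z ∈ treePaths T ∧ (∀ n, h 0 ≤ n → ∀ t ∈ S, (z n).2 t = V n t) ∧
      (∀ i, (¬ ∃ a s, Reserved (r := r) i (a, b, s)) →
        ∀ j, h i ≤ j → j < h (i + 1) → (z j).1 = 0) ∧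
      ∀ a (ha : a < b) s i, s ∉ S → Reserved i (a, b, s) →
        ∃ j, h i ≤ j ∧ j < h (i + 1) ∧ (z j).2 s ≠ (prev a ha j).2 s := by
    intro b prev
    -- An interval is reserved for at most one triple, so it has at most one target: the coordinate
    -- `s` of the earlier sequence `a`.
    have hch : ∀ i, ∃ o : Option (Fin r × (ℕ → Fin 2)),
        (∀ p, o = some p → p.1 ∉ S ∧ ∃ a, Reserved i (a, b, p.1)) ∧
        ∀ a (ha : a < b) s, s ∉ S → Reserved i (a, b, s) →
          o = some (s, fun j => (prev a ha j).2 s) := by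
      intro i
      by_cases hi : ∃ a, ∃ _ : a < b, ∃ s, s ∉ S ∧ Reserved (r := r) i (a, b, s)
      · obtain ⟨a, ha, s, hs, hr⟩ := hi
        refine ⟨some (s, fun j => (prev a ha j).2 s), fun p hp => ?_, fun a' ha' s' hs' hr' => ?_⟩
        · obtain rfl := Option.some.inj hp
          exact ⟨hs, a, hr⟩
        · have := hr.unique hr'
          simp only [Prod.mk.injEq, true_and] at this
          obtain ⟨rfl, rfl⟩ := this
          rfl
      · refine ⟨none, fun p hp => by simp at hp, fun a ha s hs hr => ?_⟩
        exact absurd ⟨a, ha, s, hs, hr⟩ hi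
    choose tgt htgt htgt' using hch
    obtain ⟨X, hX, hX0, hXe⟩ := exists_escaping hesc hρ V tgt fun i p hp => (htgt i p hp).1
    obtain ⟨z, hz, hzX, hzV⟩ := hV X (by rw [hρ, hX])
    rw [hρ] at hzV
    refine ⟨z, hz, hzV, fun i hi j hj hj' => ?_, fun a ha s i hs hr => ?_⟩
    · rw [hzX]
      refine hX0 i ?_ j hj hj'
      cases ho : tgt i with
      | none => rfl
      | some p =>
        obtain ⟨-, a, hr⟩ := htgt i p ho
        exact absurd ⟨a, _, hr⟩ hi
    · exact hXe i _ (htgt' i a ha s hs hr) z hz hzX hzV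
  choose f hf using step
  obtain ⟨Z, hZ⟩ := exists_strongRec f
  have hZ' := fun b => hf b fun a _ => Z a
  simp only [← hZ] at hZ'
  refine ⟨Z, fun b => (hZ' b).1, fun b => (hZ' b).2.1,
    fun a b s i ha hs hr => (hZ' b).2.2.2 a ha s i hs hr, fun j hj => ?_⟩
  obtain ⟨i, hi, hi'⟩ := exists_interval (strictMono_nat_of_lt_succ fun i => (hesc i).1) hj
  -- On an interval reserved for `(a, b, s)` only sequence `b` can have a nonzero color, so some
  -- third color avoids both 0 and the color of `b`.
  by_cases hr : ∃ b a s, Reserved (r := r) i (a, b, s)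
  · obtain ⟨b, a, s, hr⟩ := hr
    have h3 : ∀ x : Fin 3, ∃ c, 0 ≠ c ∧ x ≠ c := by decide
    obtain ⟨c, hc, hc'⟩ := h3 (Z b j).1
    refine ⟨c, fun b' => ?_⟩
    by_cases hb : b' = b
    · rwa [hb]
    · rwa [(hZ' b').2.2.1 i _ j hi hi']
      rintro ⟨a', s', hr'⟩
      have := hr.unique hr'
      simp only [Prod.mk.injEq] at this
      exact hb this.2.1.symm
  · refine ⟨1, fun b => ?_⟩
    rw [(hZ' b).2.2.1 i (fun ⟨a, s, h⟩ => hr ⟨b, a, s, h⟩) j hi hi']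
    decide

/-- The letters of a star: the letters of the `r + 1` leaves, and that of the center. -/
abbrev StarLetter (r : ℕ) : Type := (Fin (r + 1) → Letter r) × Letter r

/-- At a single place the leaves of a star differ from the center in the first component, and agree
with it in the coordinates in `S`. -/
def IsStarLetter (S : Finset (Fin r)) (g : StarLetter r) : Prop :=
  ∀ a, (g.1 a).1 ≠ g.2.1 ∧ ∀ t ∈ S, (g.1 a).2 t = g.2.2 t

/-- Finite initial segments of stars: the leaves and the center lie on `T`, have the right
relation to each other from `h 0` on, and the leaves are separated on the reserved intervals. -/
def IsStarString (T : Set (List (Letter r))) (S : Finset (Fin r)) (h : ℕ → ℕ)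
    (γ : List (StarLetter r)) : Prop :=
  ((∀ a, (γ.map fun g => g.1 a) ∈ T) ∧ (γ.map Prod.snd) ∈ T) ∧
  (∀ n < γ.length, h 0 ≤ n → ∀ g ∈ γ[n]?, IsStarLetter S g) ∧
  ∀ i < γ.length, h (i + 1) ≤ γ.length → ∀ x : Fin (r + 1) × Fin (r + 1) × Fin r,
    (x.1 < x.2.1 ∧ x.2.2 ∉ S) → Reserved i ((x.1 : ℕ), (x.2.1 : ℕ), x.2.2) →
      ∃ j < h (i + 1), h i ≤ j ∧ ∃ g ∈ γ[j]?, (g.1 x.2.1).2 x.2.2 ≠ (g.1 x.1).2 x.2.2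

/-- `V` does not occur in the condition, so only `T` and `h` need to be computable. -/
theorem computablePred_isStarString {T : Set (List (Letter r))}
    (hT : ComputablePred fun σ => σ ∈ T) (S : Finset (Fin r)) {h : ℕ → ℕ} (hh : Computable h) :
    ComputablePred (IsStarString T S h) := by
  have hget : Computable₂ fun (γ : List (StarLetter r)) (n : ℕ) => γ[n]? :=
    Computable.list_getElem?
  refine ComputablePred.and (ComputablePred.and ?_ ?_) (ComputablePred.and ?_ ?_)
  · refine ComputablePred.forall_fintype
      (p := fun (γ : List (StarLetter r)) a => (γ.map fun g => g.1 a) ∈ T) (hT.comp ?_)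
    refine Primrec.to_comp (Primrec.list_map Primrec.fst ?_)
    exact Primrec.fin_app.comp (Primrec.fst.comp Primrec.snd) (Primrec.snd.comp Primrec.fst)
  · exact hT.comp (Primrec.list_map Primrec.id (Primrec.snd.comp Primrec.snd).to₂).to_comp
  · refine ComputablePred.forall_lt (p := fun (γ : List (StarLetter r)) n =>
      h 0 ≤ n → ∀ g ∈ γ[n]?, IsStarLetter S g) ?_ Computable.list_length
    refine ComputablePred.imp (Computable.lePred (Computable.const _) Computable.snd) ?_
    exact (primrecPred_of_finite fun o : Option (StarLetter r) =>
      ∀ g ∈ o, IsStarLetter S g).computablePred.comp (hget.comp Computable.fst Computable.snd)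
  · refine ComputablePred.forall_lt (p := fun (γ : List (StarLetter r)) i =>
      h (i + 1) ≤ γ.length → ∀ x : Fin (r + 1) × Fin (r + 1) × Fin r,
      (x.1 < x.2.1 ∧ x.2.2 ∉ S) → Reserved i ((x.1 : ℕ), (x.2.1 : ℕ), x.2.2) →
      ∃ j < h (i + 1), h i ≤ j ∧ ∃ g ∈ γ[j]?, (g.1 x.2.1).2 x.2.2 ≠ (g.1 x.1).2 x.2.2)
      ?_ Computable.list_length
    have hs : Computable fun y : List (StarLetter r) × ℕ => h (y.2 + 1) :=
      hh.comp (Computable.succ.comp Computable.snd)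
    refine ComputablePred.imp (Computable.lePred hs
      (Computable.list_length.comp Computable.fst)) ?_
    refine ComputablePred.forall_fintype
      (p := fun (y : List (StarLetter r) × ℕ) (x : Fin (r + 1) × Fin (r + 1) × Fin r) =>
      (x.1 < x.2.1 ∧ x.2.2 ∉ S) → Reserved y.2 ((x.1 : ℕ), (x.2.1 : ℕ), x.2.2) →
      ∃ j < h (y.2 + 1), h y.2 ≤ j ∧
        ∃ g ∈ y.1[j]?, (g.1 x.2.1).2 x.2.2 ≠ (g.1 x.1).2 x.2.2) ?_
    refine ComputablePred.imp ((primrecPred_of_finite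
      fun x : Fin (r + 1) × Fin (r + 1) × Fin r =>
        x.1 < x.2.1 ∧ x.2.2 ∉ S).computablePred.comp Computable.snd) (ComputablePred.imp ?_ ?_)
    · refine Computable.eqPred (Primrec.to_comp (Primrec.encode.comp ?_))
        (Computable.fst.comp (Computable.unpair.comp (Computable.snd.comp Computable.fst)))
      exact (Primrec.fin_val.comp (Primrec.fst.comp Primrec.snd)).pair
        ((Primrec.fin_val.comp (Primrec.fst.comp (Primrec.snd.comp Primrec.snd))).pair
          (Primrec.snd.comp (Primrec.snd.comp Primrec.snd)))
    · refine ComputablePred.exists_lt (p := fun (z : (List (StarLetter r) × ℕ) ×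
        (Fin (r + 1) × Fin (r + 1) × Fin r)) j => h z.1.2 ≤ j ∧ ∃ g ∈ z.1.1[j]?,
          (g.1 z.2.2.1).2 z.2.2.2 ≠ (g.1 z.2.1).2 z.2.2.2) ?_ (hs.comp Computable.fst)
      refine ComputablePred.and (Computable.lePred (hh.comp (Computable.snd.comp
        (Computable.fst.comp Computable.fst))) Computable.snd) ?_
      have := (primrecPred_of_finite fun w : (Fin (r + 1) × Fin (r + 1) × Fin r) ×
        Option (StarLetter r) =>
          ∃ g ∈ w.2, (g.1 w.1.2.1).2 w.1.2.2 ≠ (g.1 w.1.1).2 w.1.2.2).computablePred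
      exact this.comp ((Computable.snd.comp Computable.fst).pair (hget.comp
        (Computable.fst.comp (Computable.fst.comp Computable.fst)) Computable.snd))

theorem mem_pathsOf_isStarString {T : Set (List (Letter r))} {S : Finset (Fin r)} {h : ℕ → ℕ}
    {G : ℕ → StarLetter r} :
    G ∈ pathsOf (IsStarString T S h) ↔
      ((∀ a, (fun n => (G n).1 a) ∈ treePaths T) ∧ (fun n => (G n).2) ∈ treePaths T) ∧
      (∀ n, h 0 ≤ n → IsStarLetter S (G n)) ∧
      ∀ i (a b : Fin (r + 1)) s, a < b → s ∉ S → Reserved i ((a : ℕ), (b : ℕ), s) →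
        ∃ j, h i ≤ j ∧ j < h (i + 1) ∧ ((G j).1 b).2 s ≠ ((G j).1 a).2 s := by
  constructor
  · intro hG
    refine ⟨⟨fun a n => ?_, fun n => ?_⟩, fun n hn => ?_, fun i a b s hab hs hr => ?_⟩
    · have := (hG n).1.1 a
      rwa [map_initSeg] at this
    · have := (hG n).1.2
      rwa [map_initSeg] at this
    · exact (hG (n + 1)).2.1 n (by simp) hn _ (getElem?_initSeg (Nat.lt_succ_self n))
    · obtain ⟨j, hj, hj', g, hg, hne⟩ := (hG (max (i + 1) (h (i + 1)))).2.2 i (by simp) (by simp)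
        (a, b, s) ⟨hab, hs⟩ hr
      rw [getElem?_initSeg (lt_of_lt_of_le hj (le_max_right _ _)), Option.mem_some_iff] at hg
      subst hg
      exact ⟨j, hj', hj, hne⟩
  · rintro ⟨⟨h1, h2⟩, h3, h4⟩ n
    refine ⟨⟨fun a => ?_, ?_⟩, fun k hk hk' g hg => ?_, fun i _ hi x hx hr => ?_⟩
    · rw [map_initSeg]
      exact h1 a n
    · rw [map_initSeg]
      exact h2 n
    · rw [length_initSeg] at hk
      rw [getElem?_initSeg hk, Option.mem_some_iff] at hg
      exact hg ▸ h3 k hk'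
    · obtain ⟨j, hj, hj', hne⟩ := h4 i x.1 x.2.1 x.2.2 hx.1 hx.2 hr
      rw [length_initSeg] at hi
      exact ⟨j, hj', hj, _, getElem?_initSeg (hj'.trans_le hi), hne⟩

/-- The first `r + 1` separated paths are the leaves. The center's colors are `ρ` followed by the
free colors, and constancy above `ρ` makes it follow `V` on `S`. -/
theorem nonempty_pathsOf_isStarString {T : Set (List (Letter r))} {S : Finset (Fin r)} {h : ℕ → ℕ}
    (hesc : ∀ i, EscapeBound T S (h i) (h (i + 1))) {ρ : List (Fin 3)} (hρ : ρ.length = h 0)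
    {V : ℕ → Fin r → Fin 2} (hV : IsConstantAbove T S ρ V) :
    (pathsOf (IsStarString T S h)).Nonempty := by
  obtain ⟨Z, hZT, hZV, hZs, hZc⟩ := exists_separated_paths hesc hρ hV
  choose! c hc using hZc
  obtain ⟨z, hz, hzX, hzV⟩ := hV (fun n => if hn : n < ρ.length then ρ[n] else c n)
    (initSeg_eq_iff.2 fun i hi => by simp [hi])
  refine ⟨fun n => (fun a => Z a n, z n), mem_pathsOf_isStarString.2
    ⟨⟨fun a => hZT a, hz⟩, fun n hn a => ⟨?_, fun t ht => ?_⟩, fun i a b s hab hs hr => ?_⟩⟩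
  · change (Z a n).1 ≠ (z n).1
    rw [hzX, dif_neg (by omega)]
    exact hc n hn a
  · exact (hZV a n hn t ht).trans (hzV n (by omega) t ht).symm
  · exact hZs a b s i hab hs hr

/-- By full projection the empty set qualifies, and there are finitely many sets of coordinates.
Maximality refers to all `ρ` and `V`, not only to those chosen. -/
theorem exists_maximal_isConstantAbove {T : Set (List (Letter r))}
    (hproj : ∀ X : ℕ → Fin 3, ∃ Z ∈ treePaths T, ∀ n, (Z n).1 = X n) :
    ∃ (S : Finset (Fin r)) (ρ : List (Fin 3)) (V : ℕ → Fin r → Fin 2), IsConstantAbove T S ρ V ∧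
      ∀ s, s ∉ S → ∀ ρ V, ¬ IsConstantAbove T (insert s S) ρ V := by
  have hne : {S : Finset (Fin r) | ∃ ρ V, IsConstantAbove T S ρ V}.Nonempty :=
    ⟨∅, [], fun _ _ => 0, fun X _ => by
      obtain ⟨Z, hZ, hZX⟩ := hproj X
      exact ⟨Z, hZ, hZX, by simp⟩⟩
  obtain ⟨S, hS⟩ :=
    (Set.toFinite {S : Finset (Fin r) | ∃ ρ V, IsConstantAbove T S ρ V}).exists_maximal hne
  obtain ⟨ρ, V, hV⟩ := hS.prop
  refine ⟨S, ρ, V, hV, fun s hs ρ' V' h' => hs ?_⟩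
  exact hS.le_of_ge ⟨ρ', V', h'⟩ (Finset.subset_insert s S) (Finset.mem_insert_self s S)

/-- A function computed pointwise from a sequence is Turing reducible to it. -/
theorem turingReducible_seqOracle {α : Type*} [Primcodable α] (Z : ℕ → α) {u : ℕ → α → ℕ}
    (hu : Computable₂ u) {f : ℕ → ℕ} (hf : ∀ n, f n = u n (Z (n / 2))) :
    TuringReducible (f : ℕ →. ℕ) (seqOracle Z : ℕ →. ℕ) := by
  have hk : Computable fun x : ℕ =>
      ((Encodable.decode (α := α) x.unpair.2).map (u x.unpair.1)).getD 0 := by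
    refine Computable.option_getD (Computable.option_map (Computable.decode.comp
      (Computable.snd.comp Computable.unpair)) ?_) (Computable.const 0)
    exact hu.comp (Computable.fst.comp (Computable.unpair.comp Computable.fst)) Computable.snd
  have hdiv : Computable fun n : ℕ => n / 2 :=
    (Primrec.nat_div.comp Primrec.id (Primrec.const 2)).to_comp
  have hor : Nat.RecursiveIn {(seqOracle Z : ℕ →. ℕ)} (seqOracle Z : ℕ →. ℕ) :=
    .oracle _ (Set.mem_singleton _)
  have hrec : ∀ {g : ℕ → ℕ}, Computable g →
      Nat.RecursiveIn {(seqOracle Z : ℕ →. ℕ)} (g : ℕ →. ℕ) := fun hg =>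
    (Partrec.nat_iff.1 hg).recursiveIn
  refine RecursiveIn.iff_nat.2 (((hrec hk).comp ((hrec Computable.id).pair
    (hor.comp (hrec hdiv)))).of_eq_tot fun n => ?_)
  have h2 : Nat.pair n (Encodable.encode (Z (n / 2))) ∈
      (Nat.pair <$> (Part.some n) <*> ((Part.some (n / 2)) >>= (seqOracle Z : ℕ →. ℕ))) := by
    simp only [Seq.seq, Part.map_eq_map, Part.map_some, Part.bind_some]
    exact Part.mem_map _ (Part.mem_bind (Part.mem_some _) (Part.mem_some _))
  refine Part.mem_bind_iff.2 ⟨_, h2, ?_⟩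
  simp [hf]

theorem not_almostDisjoint_of_frequently_eq {Y₀ Y₁ : ℕ → Fin 2}
    (h : ∀ m, ∃ n, m ≤ n ∧ Y₀ n = Y₁ n) : ¬ AlmostDisjoint Y₀ Y₁ := by
  intro hd
  have hfin : (⋃ j : Fin 2, Y₀ ⁻¹' {j} ∩ Y₁ ⁻¹' {j}).Finite := Set.finite_iUnion hd
  obtain ⟨m, hm⟩ := hfin.bddAbove
  obtain ⟨n, hn, he⟩ := h (m + 1)
  have := hm (Set.mem_iUnion.2 ⟨Y₁ n, he, rfl⟩)
  omega

end Stars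

/-! ### The choice of a leaf and the conclusion -/

theorem mainTheorem5 (r : ℕ) (Q : Set (ColoringSpace r))
    (hQ : IsPi01 Q) (hproj : HasFullProjection Q)
    (D : ℕ → Fin 2) (hD : ¬ Computable D) :
    ∃ (X₀ X₁ : ℕ → Fin 3) (Y₀ Y₁ : Fin r → ℕ → Fin 2),
      (X₀, Y₀) ∈ Q ∧ (X₁, Y₁) ∈ Q ∧
      AlmostDisjoint X₀ X₁ ∧
      (∀ s : Fin r, ¬ AlmostDisjoint (Y₀ s) (Y₁ s)) ∧
      ¬ TuringReducible (seqOracle D : ℕ →. ℕ)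
          (pointJoin (X₀, Y₀) (X₁, Y₁) : ℕ →. ℕ) := by
  obtain ⟨T, hT, hTc, hQT⟩ := hQ
  have hmem : ∀ Z ∈ treePaths T, (asSeq r).symm Z ∈ Q := fun Z hZ => by
    rw [← hQT] at hZ
    obtain ⟨p, hp, rfl⟩ := hZ
    rwa [Equiv.symm_apply_apply]
  obtain ⟨S, ρ, V, hV, hS⟩ := exists_maximal_isConstantAbove (T := T) fun X => by
    obtain ⟨Y, hY⟩ := hproj X
    exact ⟨asSeq r (X, Y), hQT ▸ Set.mem_image_of_mem _ hY, fun _ => rfl⟩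
  obtain ⟨h, hh, h0, hesc⟩ := exists_escapeBound_seq hT hTc hS ρ.length
  obtain ⟨G, hG, hGD⟩ := exists_mem_pathsOf_not_turingReducible
    (computablePred_isStarString hTc S hh) (nonempty_pathsOf_isStarString hesc h0.symm hV) hD
  obtain ⟨⟨hleaf, hcenter⟩, hstar, hsep⟩ := mem_pathsOf_isStarString.1 hG
  have hmono : StrictMono h := strictMono_nat_of_lt_succ fun i => (hesc i).1
  -- Pigeonhole: if each of the `r + 1` leaves eventually opposes the center in one of the `r`
  -- coordinates, two leaves do so in the same one.
  obtain ⟨a, ha⟩ : ∃ a : Fin (r + 1), ∀ s m, ∃ n, m ≤ n ∧ ((G n).1 a).2 s = (G n).2.2 s := by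
    by_contra! hcon
    choose s m hm using hcon
    obtain ⟨a, b, hab, hsab⟩ := Fintype.exists_ne_map_eq_of_card_lt s (by simp)
    wlog hlt : a < b generalizing a b
    · exact this b a hab.symm hsab.symm (lt_of_le_of_ne (not_lt.1 hlt) hab.symm)
    have hs : s a ∉ S := fun hs =>
      hm a (max (m a) (h 0)) (le_max_left _ _) ((hstar _ (le_max_right _ _) a).2 _ hs)
    -- As `h` is strictly increasing, the places of interval `i` are at least `i`, hence past both
    -- thresholds. There both leaves oppose the center, so they agree.
    obtain ⟨i, hi, hr⟩ := exists_reserved_ge ((a : ℕ), (b : ℕ), s a) (max (m a) (m b))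
    obtain ⟨j, hj, -, hne⟩ := hsep i a b (s a) hlt hs hr
    have hij : i ≤ j := hmono.le_apply.trans hj
    have h2 : ∀ x y z : Fin 2, x ≠ z → y ≠ z → x = y := by decide
    refine hne (h2 _ _ _ ?_ (hm a j (by omega)))
    rw [hsab]
    exact hm b j (by omega)
  refine ⟨fun n => ((G n).1 a).1, fun n => (G n).2.1, fun s n => ((G n).1 a).2 s,
    fun s n => (G n).2.2 s, hmem _ (hleaf a), hmem _ hcenter, fun j => ?_,
    fun s => not_almostDisjoint_of_frequently_eq (ha s), fun hred => hGD (hred.trans ?_)⟩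
  -- Leaf and center have different colors from `h 0` on.
  · refine (Set.finite_lt_nat (h 0)).subset fun n hn => ?_
    by_contra hn'
    exact (hstar n (not_lt.1 hn') a).1 (hn.1.trans hn.2.symm)
  · have h1 : Primrec fun x : ℕ × StarLetter r => x.2.1 a :=
      Primrec.fin_app.comp (Primrec.fst.comp Primrec.snd) (Primrec.const a)
    have h2 : Primrec fun x : ℕ × StarLetter r => x.2.2 := Primrec.snd.comp Primrec.snd
    have h3 : Primrec fun x : ℕ × StarLetter r => decide (x.1 % 2 = 0) :=
      Primrec.eq.decide.comp (Primrec.nat_mod.comp Primrec.fst (Primrec.const 2))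
        (Primrec.const 0)
    refine turingReducible_seqOracle G (u := fun n g => bif decide (n % 2 = 0) then
      seqOracle (fun _ : ℕ => g.1 a) 0 else seqOracle (fun _ : ℕ => g.2) 0) ?_ fun n => ?_
    · exact Computable.cond h3.to_comp (Primrec.encode.comp h1).to_comp
        (Primrec.encode.comp h2).to_comp
    · simp only [pointJoin, oracleJoin, Bool.cond_decide]
      rfl
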